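/- Let $K$ be a field complete with respect to a discrete valuation, with ring of integers $\mathcal{O}_K$ and algebraically closed residue field $k$, and put $S=\operatorname{Spec}\mathcal{O}_K$. Let $L/K$ be a finite Galois extension with $L\neq K$ that is tame, i.e. the order of $G=\operatorname{Gal}(L/K)$ is prime to $\operatorname{char}(k)$ (no condition if $\operatorname{char}(k)=0$). Let $\mathcal{O}_L$ be the ring of integers of $L$, put $T=\operatorname{Spec}\mathcal{O}_L$ with its Galois action, and let $\pi_T:T\to S$ be the natural morphism. Let $X$ be a smooth $K$-variety (a geometrically integral, separated, smooth $K$-scheme of finite type), and let $X_L=X\times_K L$ carry the Galois action (trivial on $X$, natural on $L$). Let $\varphi:\mathcal{Y}\to T$ be a smooth model of $X_L$, i.e. $\mathcal{Y}$ is an integral scheme, $\varphi$ is smooth and of finite type, and the generic fibre of $\varphi$ is identified with $X_L$. Suppose $\mathcal{Y}$ has an action of $G$ extending the Galois action on $X_L$ which is good, i.e. every orbit lies in an affine open subscheme. Let $\pi:\mathcal{Y}\to\mathcal{X}=\mathcal{Y}/G$ be the quotient in the category of schemes, with its structure morphism $\varphi_G:\mathcal{X}\to S$, which satisfies $\varphi_G\circ\pi=\pi_T\circ\varphi$.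 Let $\mathcal{Y}^G\subset\mathcal{Y}$ be the fixed locus, the subscheme representing the functor of $G$-fixed points of $\mathcal{Y}$. 1. If $\mathcal{Y}^G\neq\emptyset$, then $\mathcal{X}(\mathcal{O}_K)\neq\emptyset$, i.e. $\varphi_G$ has a section; moreover $\mathcal{Y}^G$ then contains a closed point of $\mathcal{Y}$. 2. For every closed point $y$ of $\mathcal{Y}$ that lies in $\mathcal{Y}^G$ there is a $G$-equivariant section $\sigma:T\to\mathcal{Y}$ of $\varphi$ that maps the closed point of $T$ to $y$. There is a unique morphism $\sigma_G:S\to\mathcal{X}$ with $\sigma_G\circ\pi_T=\pi\circ\sigma$; it is a section of $\varphi_G$, and it maps the closed point of $S$ to $\pi(y)$. This holds whether or not $\mathcal{X}$ is singular at $\pi(y)$. -/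

import Mathlib

open CategoryTheory CategoryTheory.Limits AlgebraicGeometry

universe u

noncomputable section

namespace GaloisQuotient

/-! ### Group actions on schemes

A left action of an abstract group `G` on a scheme `Y` is a homomorphism `ρ : G →* Aut Y`.  In
Mathlib the multiplication of `Aut Y` is composition of functions, `(a * b).hom = b.hom ≫ a.hom`. -/

/-- A morphism `f : U ⟶ V` is `G`-equivariant: `f ∘ ρ(g) = τ(g) ∘ f` for all `g`. -/
def IsEquivariant {G : Type u} [Group G] {U V : Scheme.{u}} (ρ : G →* Aut U) (τ : G →* Aut V)
    (f : U ⟶ V) : Prop :=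
  ∀ g : G, (ρ g).hom ≫ f = f ≫ (τ g).hom

/-- An action is good if every orbit is contained in an affine open subscheme. -/
def IsGoodAction {G : Type u} [Group G] {Y : Scheme.{u}} (ρ : G →* Aut Y) : Prop :=
  ∀ y : Y, ∃ U : Y.Opens, IsAffineOpen U ∧ ∀ g : G, (ρ g).hom y ∈ U

/-- `π : Y ⟶ Q` is the quotient of `Y` by `G` in the category of schemes: it is `G`-invariant,
and every `G`-invariant morphism from `Y` to a scheme factors uniquely through it. -/
structure IsQuotientBy {G : Type u} [Group G] {Y Q : Scheme.{u}} (ρ : G →* Aut Y)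
    (π : Y ⟶ Q) : Prop where
  invariant : ∀ g : G, (ρ g).hom ≫ π = π
  existsUnique_desc : ∀ (W : Scheme.{u}) (f : Y ⟶ W), (∀ g : G, (ρ g).hom ≫ f = f) →
    ∃! f' : Q ⟶ W, π ≫ f' = f

/-- The fixed locus `Y^G`: the equalizer of `(ρ(g))_g` and `(id)_g : Y ⟶ ∏_{g ∈ G} Y`. By
`existsUnique_lift_fixedLocus` it represents the functor of `G`-fixed points. -/
def fixedLocus {G : Type u} [Group G] [Finite G] {Y : Scheme.{u}} (ρ : G →* Aut Y) :
    Scheme.{u} :=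
  equalizer (Pi.lift fun g : G => (ρ g).hom) (Pi.lift fun _ : G => 𝟙 Y)

/-- The inclusion of the fixed locus. -/
def fixedLocusι {G : Type u} [Group G] [Finite G] {Y : Scheme.{u}} (ρ : G →* Aut Y) :
    fixedLocus ρ ⟶ Y :=
  equalizer.ι (Pi.lift fun g : G => (ρ g).hom) (Pi.lift fun _ : G => 𝟙 Y)

theorem fixedLocusι_comp {G : Type u} [Group G] [Finite G] {Y : Scheme.{u}} (ρ : G →* Aut Y)
    (g : G) : fixedLocusι ρ ≫ (ρ g).hom = fixedLocusι ρ := by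
  have h := congrArg (fun f => f ≫ Pi.π (fun _ : G => Y) g)
    (equalizer.condition (Pi.lift fun g : G => (ρ g).hom) (Pi.lift fun _ : G => 𝟙 Y))
  simp only [Category.assoc, limit.lift_π, Fan.mk_π_app, Category.comp_id] at h
  exact h

/-- The morphisms `W ⟶ Y^G` are the morphisms `W ⟶ Y` that are fixed by `G`. -/
theorem existsUnique_lift_fixedLocus {G : Type u} [Group G] [Finite G] {Y : Scheme.{u}}
    (ρ : G →* Aut Y) {W : Scheme.{u}} (f : W ⟶ Y) :
    (∃! f' : W ⟶ fixedLocus ρ, f' ≫ fixedLocusι ρ = f) ↔ ∀ g : G, f ≫ (ρ g).hom = f := by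
  constructor
  · rintro ⟨f', rfl, -⟩ g
    rw [Category.assoc, fixedLocusι_comp]
  · intro h
    refine ⟨equalizer.lift f (Pi.hom_ext _ _ fun g => by simp [h g]), equalizer.lift_ι _ _, ?_⟩
    intro m hm
    exact equalizer.hom_ext (hm.trans (equalizer.lift_ι _ _).symm)

/-! ### The Galois actions -/

/-- The left action on `Spec A` induced by a left action of `G` on a ring `A`: the element `g`
acts by the morphism of spectra attached to `a ↦ g⁻¹ • a`. -/
def specAction (G : Type u) [Group G] (A : Type u) [CommRing A] [MulSemiringAction G A] :
    G →* Aut (Spec (.of A)) where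
  toFun g :=
    { hom := Spec.map (CommRingCat.ofHom (MulSemiringAction.toRingHom G A g⁻¹))
      inv := Spec.map (CommRingCat.ofHom (MulSemiringAction.toRingHom G A g))
      hom_inv_id := by
        rw [← Spec.map_comp, ← Spec.map_id, ← CommRingCat.ofHom_comp]
        congr 1; ext a; simp
      inv_hom_id := by
        rw [← Spec.map_comp, ← Spec.map_id, ← CommRingCat.ofHom_comp]
        congr 1; ext a; simp }
  map_one' := by
    apply Aut.ext
    change Spec.map _ = 𝟙 _
    rw [← Spec.map_id]
    congr 1; ext a; simp
  map_mul' g h := by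
    apply Aut.ext
    change Spec.map _ = Spec.map _ ≫ Spec.map _
    rw [← Spec.map_comp, ← CommRingCat.ofHom_comp]
    congr 1; ext a; simp [mul_smul]

section Galois

variable (O K L : Type u) [CommRing O] [Field K] [Field L] [Algebra O K] [Algebra K L]
  [Algebra O L] [IsScalarTower O K L]

/-- The Galois action on the ring of integers `𝒪_L`, the integral closure of `O = 𝒪_K` in `L`:
the restriction of the action of `Gal(L/K)` on `L`. -/
instance galoisActionIntegers : MulSemiringAction Gal(L/K) (integralClosure O L) :=
  haveI : SMulCommClass Gal(L/K) O L :=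
    ⟨fun g a x => by
      rw [← IsScalarTower.algebraMap_smul K a x, ← IsScalarTower.algebraMap_smul K a (g • x)]
      exact map_smul g _ _⟩
  inferInstance

theorem coe_galoisActionIntegers (g : Gal(L/K)) (a : integralClosure O L) :
    ((g • a : integralClosure O L) : L) = g (a : L) := rfl

/-- `T = Spec 𝒪_L`. -/
abbrev specIntegers : Scheme.{u} := Spec (.of (integralClosure O L))

/-- `Spec L ⟶ Spec K`. -/
abbrev specFieldMap : Spec (.of L) ⟶ Spec (.of K) :=
  Spec.map (CommRingCat.ofHom (algebraMap K L))

/-- `T ⟶ S = Spec 𝒪_K`. -/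
abbrev specIntegersMap : specIntegers O L ⟶ Spec (.of O) :=
  Spec.map (CommRingCat.ofHom (algebraMap O (integralClosure O L)))

/-- The Galois action on `T = Spec 𝒪_L`. -/
abbrev galoisActionT : Gal(L/K) →* Aut (specIntegers O L) :=
  specAction Gal(L/K) (integralClosure O L)

variable {K}

/-- The base change `X_L = X ×_K Spec L`. -/
abbrev baseChange {X : Scheme.{u}} (p : X ⟶ Spec (.of K)) : Scheme.{u} :=
  pullback p (specFieldMap K L)

theorem specAction_comp_specFieldMap (g : Gal(L/K)) :
    (specAction Gal(L/K) L g).hom ≫ specFieldMap K L = specFieldMap K L := by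
  change Spec.map _ ≫ Spec.map _ = Spec.map _
  rw [← Spec.map_comp, ← CommRingCat.ofHom_comp]
  congr 1; ext a
  exact AlgEquiv.commutes g⁻¹ a

/-- The morphism `id_X × g : X_L ⟶ X_L`. -/
def galoisHomBaseChange {X : Scheme.{u}} (p : X ⟶ Spec (.of K)) (g : Gal(L/K)) :
    baseChange L p ⟶ baseChange L p :=
  pullback.lift (pullback.fst _ _) (pullback.snd _ _ ≫ (specAction Gal(L/K) L g).hom)
    (by rw [Category.assoc, specAction_comp_specFieldMap, pullback.condition])

theorem galoisHomBaseChange_fst {X : Scheme.{u}} (p : X ⟶ Spec (.of K)) (g : Gal(L/K)) :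
    galoisHomBaseChange L p g ≫ pullback.fst p (specFieldMap K L) = pullback.fst _ _ :=
  pullback.lift_fst _ _ _

theorem galoisHomBaseChange_snd {X : Scheme.{u}} (p : X ⟶ Spec (.of K)) (g : Gal(L/K)) :
    galoisHomBaseChange L p g ≫ pullback.snd p (specFieldMap K L) =
      pullback.snd _ _ ≫ (specAction Gal(L/K) L g).hom :=
  pullback.lift_snd _ _ _

theorem galoisHomBaseChange_one {X : Scheme.{u}} (p : X ⟶ Spec (.of K)) :
    galoisHomBaseChange L p 1 = 𝟙 _ := by
  apply pullback.hom_ext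
  · rw [galoisHomBaseChange_fst, Category.id_comp]
  · rw [galoisHomBaseChange_snd, Category.id_comp, map_one]
    exact Category.comp_id _

theorem galoisHomBaseChange_mul {X : Scheme.{u}} (p : X ⟶ Spec (.of K)) (g h : Gal(L/K)) :
    galoisHomBaseChange L p (g * h) = galoisHomBaseChange L p h ≫ galoisHomBaseChange L p g := by
  apply pullback.hom_ext
  · rw [Category.assoc, galoisHomBaseChange_fst, galoisHomBaseChange_fst, galoisHomBaseChange_fst]
  · rw [Category.assoc, galoisHomBaseChange_snd, galoisHomBaseChange_snd, ← Category.assoc,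
      galoisHomBaseChange_snd, map_mul, Category.assoc]
    rfl

/-- The Galois action on `X_L`: the element `g` acts by `id_X × g`. -/
def galoisActionBaseChange {X : Scheme.{u}} (p : X ⟶ Spec (.of K)) :
    Gal(L/K) →* Aut (baseChange L p) where
  toFun g :=
    { hom := galoisHomBaseChange L p g
      inv := galoisHomBaseChange L p g⁻¹
      hom_inv_id := by
        rw [← galoisHomBaseChange_mul, inv_mul_cancel, galoisHomBaseChange_one]
      inv_hom_id := by
        rw [← galoisHomBaseChange_mul, mul_inv_cancel, galoisHomBaseChange_one] }
  map_one' := Aut.ext (galoisHomBaseChange_one L p)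
  map_mul' g h := Aut.ext (galoisHomBaseChange_mul L p g h)

end Galois

/-! ### Varieties and models -/

/-- A variety over a field `F`: a geometrically integral, separated `F`-scheme of finite type. -/
structure IsVariety {F : Type u} [Field F] {X : Scheme.{u}} (p : X ⟶ Spec (.of F)) : Prop where
  geometricallyIntegral : GeometricallyIntegral p
  isSeparated : IsSeparated p
  locallyOfFiniteType : LocallyOfFiniteType p
  quasiCompact : QuasiCompact p

/-- `φ : Y ⟶ Spec R` is a model of `q : V ⟶ Spec F`, where `F` is the fraction field of `R`:
`Y` is integral and of finite type over `R`, and `j : V ⟶ Y` identifies `V` with the generic fibre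
of `Y`. -/
structure IsModel {R F : Type u} [CommRing R] [Field F] [Algebra R F] {V Y : Scheme.{u}}
    (q : V ⟶ Spec (.of F)) (φ : Y ⟶ Spec (.of R)) (j : V ⟶ Y) : Prop where
  isIntegral : IsIntegral Y
  locallyOfFiniteType : LocallyOfFiniteType φ
  quasiCompact : QuasiCompact φ
  isPullback : IsPullback j q φ (Spec.map (CommRingCat.ofHom (algebraMap R F)))

/-- The extension `L/K` is tame: the order of `Gal(L/K)` is prime to the characteristic of the
residue field `k` of `O = 𝒪_K` (to its characteristic exponent, so nothing is required if `k` has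
characteristic zero). -/
def IsTame (O K L : Type u) [CommRing O] [IsLocalRing O] [Field K] [Field L] [Algebra K L] :
    Prop :=
  (Nat.card Gal(L/K)).Coprime (ringExpChar (IsLocalRing.ResidueField O))

end GaloisQuotient

end

namespace GaloisQuotient

/-! ### Completeness and locality of finite algebras over a complete local ring -/

section Completeness

open AdicCompletion TensorProduct

/-! The heart is an equivariant form of Hensel's lemma. Since `O` is complete, `𝒪_L` is again a
complete local ring. Write `A` for the local ring of `Y` at a closed fixed point `y`: it is formally
smooth over `𝒪_L`, carries a semilinear action of `G`, and its residue field is `k`. A map `A →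
𝒪_L/𝔪` lifts step by step to `𝒪_L/𝔪ⁿ`. At each step the conjugates of a lift by the elements of `G`
differ by elements of an ideal of square zero, and tameness allows them to be averaged into an
equivariant lift (`exists_equivariant_lift_of_isAdicComplete`). The limit is the section `σ`.

The start of the induction needs `G` to act trivially on the residue field of `A`. This comes from
`y` lying in the scheme-theoretic fixed locus. Because `L ≠ K`, a fixed point lies over the closed
point of `T` (`exists_isLocalHom_of_fixed`), and the Nullstellensatz with `k` algebraically closed
identifies the residue fields.

Descent happens on `T`, not near `π y`: the invariant morphism `π ∘ σ` factors through a single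
local ring of `Q`, whose image in `𝒪_L` lies in the invariants, that is, in `O`. Hence singularities
of `Q` play no role. -/

/-- For finite `M`, the completion of `R` tensored with `M` surjects onto the completion of `M`, and
`R` already surjects onto its own completion. -/
theorem isPrecomplete_of_finite {R : Type*} [CommRing R] (I : Ideal R) [IsAdicComplete I R]
    (M : Type*) [AddCommGroup M] [Module R M] [Module.Finite R M] : IsPrecomplete I M := by
  rw [← AdicCompletion.of_surjective_iff]
  intro x
  obtain ⟨t, rfl⟩ := ofTensorProduct_surjective_of_finite I M x
  induction t with
  | zero => exact ⟨0, by simp⟩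
  | add s t hs ht =>
    obtain ⟨a, ha⟩ := hs
    obtain ⟨b, hb⟩ := ht
    exact ⟨a + b, by rw [map_add, map_add, ha, hb]⟩
  | tmul r m =>
    obtain ⟨r, rfl⟩ := AdicCompletion.of_surjective I R r
    refine ⟨r • m, ?_⟩
    rw [ofTensorProduct_tmul, map_smul]
    exact (algebraMap_smul (AdicCompletion I R) r (of I M m)).symm

theorem isAdicComplete_map_maximalIdeal (R B : Type*) [CommRing R] [IsLocalRing R]
    [IsNoetherianRing R] [IsAdicComplete (IsLocalRing.maximalIdeal R) R] [CommRing B] [Algebra R B]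
    [Module.Finite R B] :
    IsAdicComplete ((IsLocalRing.maximalIdeal R).map (algebraMap R B)) B := by
  rw [IsAdicComplete.map_algebraMap_iff]
  exact { toIsHausdorff := inferInstance, toIsPrecomplete := isPrecomplete_of_finite _ _ }

theorem smodEq_pow_iff {B : Type*} [CommRing B] (I : Ideal B) (n : ℕ) (x y : B) :
    x ≡ y [SMOD (I ^ n • ⊤ : Submodule B B)] ↔ x - y ∈ I ^ n := by
  rw [SModEq.sub_mem, smul_eq_mul, Ideal.mul_top]

/-- The two ideals define the same topology. It serves to pass from the extension of the maximal
ideal of `R` to the maximal ideal of `B`. -/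
theorem isAdicComplete_of_pow_le {B : Type*} [CommRing B] (I J : Ideal B) [IsAdicComplete I B]
    (hIJ : I ≤ J) {e : ℕ} (he : J ^ e ≤ I) : IsAdicComplete J B := by
  -- The exponent `e + 1` is positive even for `e = 0`, so that `n ≤ (e + 1) * n` below.
  have he' : J ^ (e + 1) ≤ I := (Ideal.pow_le_pow_right e.le_succ).trans he
  have hpow (n : ℕ) : J ^ ((e + 1) * n) ≤ I ^ n := by
    rw [pow_mul]; exact Ideal.pow_right_mono he' n
  have hle (n : ℕ) : n ≤ (e + 1) * n := Nat.le_mul_of_pos_left n e.succ_pos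
  refine { haus' := fun x hx ↦ ?_, prec' := fun f hf ↦ ?_ }
  · refine IsHausdorff.haus (I := I) inferInstance x fun n ↦ ?_
    have := hx ((e + 1) * n)
    rw [smodEq_pow_iff] at this ⊢
    exact hpow n this
  -- A `J`-Cauchy sequence has an `I`-Cauchy subsequence, whose limit is also the `J`-limit of the
  -- whole sequence.
  · obtain ⟨L, hL⟩ := IsPrecomplete.prec (I := I) inferInstance (f := fun n ↦ f ((e + 1) * n))
      (fun {m n} hmn ↦ by
        have := hf (Nat.mul_le_mul_left (e + 1) hmn)
        rw [smodEq_pow_iff] at this ⊢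
        exact hpow m this)
    refine ⟨L, fun n ↦ ?_⟩
    refine (hf (hle n)).trans ?_
    have := hL n
    rw [smodEq_pow_iff] at this ⊢
    exact Ideal.pow_right_mono hIJ n this

open Polynomial in
-- Hensel's lemma for `X ^ 2 - X`: the derivative `2a - 1` at `a` is its own inverse modulo `I`,
-- because `(2a - 1)² = 1 + 4(a² - a)`.
theorem exists_isIdempotentElem_sub_mem {B : Type*} [CommRing B] (I : Ideal B) [HenselianRing B I]
    {a : B} (ha : a * a - a ∈ I) : ∃ e : B, IsIdempotentElem e ∧ e - a ∈ I := by
  obtain ⟨e, he, hea⟩ := HenselianRing.is_henselian (I := I) (X ^ 2 - X : B[X])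
    (by monicity!) a (by simpa [sq] using ha) (by
      refine IsUnit.of_mul_eq_one (Ideal.Quotient.mk I (2 * a - 1)) ?_
      rw [← map_mul, ← map_one (Ideal.Quotient.mk I), Ideal.Quotient.eq]
      have : (eval a (derivative (X ^ 2 - X : B[X]))) * (2 * a - 1) - 1 = 4 * (a * a - a) := by
        simp; ring
      rw [this]
      exact I.mul_mem_left _ ha)
  exact ⟨e, by simpa [sq, IsIdempotentElem, sub_eq_zero] using he, hea⟩

/-- A domain that is finite over a complete Noetherian local ring is local. -/
theorem isLocalRing_of_finite_of_isAdicComplete (R B : Type*) [CommRing R] [IsLocalRing R]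
    [IsNoetherianRing R] [IsAdicComplete (IsLocalRing.maximalIdeal R) R] [CommRing B] [IsDomain B]
    [Algebra R B] [Module.Finite R B] : IsLocalRing B := by
  let I := (IsLocalRing.maximalIdeal R).map (algebraMap R B)
  have : IsAdicComplete I B := isAdicComplete_map_maximalIdeal R B
  have hI (M : Ideal B) [M.IsMaximal] : I ≤ M :=
    ((IsAdicComplete.le_jacobson_bot I).trans (sInf_le ⟨bot_le, inferInstance⟩))
  have : IsArtinianRing (B ⧸ I) := by
    let : Field (R ⧸ IsLocalRing.maximalIdeal R) := Ideal.Quotient.field _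
    have : Module.Finite R (B ⧸ I) :=
      Module.Finite.of_surjective (Ideal.Quotient.mkₐ R I).toLinearMap
        Ideal.Quotient.mk_surjective
    let : Algebra (R ⧸ IsLocalRing.maximalIdeal R) (B ⧸ I) :=
      (Ideal.quotientMap I (algebraMap R B) Ideal.le_comap_map).toAlgebra
    have : IsScalarTower R (R ⧸ IsLocalRing.maximalIdeal R) (B ⧸ I) :=
      .of_algebraMap_eq fun x ↦ rfl
    have : Module.Finite (R ⧸ IsLocalRing.maximalIdeal R) (B ⧸ I) :=
      Module.Finite.of_restrictScalars_finite R _ _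
    exact IsArtinianRing.of_finite (R ⧸ IsLocalRing.maximalIdeal R) (B ⧸ I)
  obtain ⟨M₀, hM₀⟩ := Ideal.exists_maximal B
  refine IsLocalRing.of_unique_max_ideal ⟨M₀, hM₀, fun M hM ↦ ?_⟩
  have hp (N : Ideal B) (hN : N.IsMaximal) : (N.map (Ideal.Quotient.mk I)).IsPrime :=
    Ideal.map_isPrime_of_surjective Ideal.Quotient.mk_surjective (by simpa using hI N)
  have hc (N : Ideal B) (hN : N.IsMaximal) :
      (N.map (Ideal.Quotient.mk I)).comap (Ideal.Quotient.mk I) = N := by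
    rw [Ideal.comap_map_of_surjective _ Ideal.Quotient.mk_surjective, sup_eq_left,
      ← RingHom.ker_eq_comap_bot, Ideal.mk_ker]
    exact hI N
  let x : PrimeSpectrum (B ⧸ I) := ⟨_, hp M hM⟩
  let y : PrimeSpectrum (B ⧸ I) := ⟨_, hp M₀ hM₀⟩
  suffices x = y by
    rw [← hc M hM, ← hc M₀ hM₀]
    exact congrArg (fun z : PrimeSpectrum (B ⧸ I) ↦ z.asIdeal.comap (Ideal.Quotient.mk I)) this
  -- The spectrum of the Artinian ring `B ⧸ I` is discrete, so an idempotent cuts out `x`. It lifts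
  -- to the domain `B`, hence is `0` or `1`; as `{x}` is nonempty it is `1`, and `x` is the only
  -- point.
  obtain ⟨e, he, hxe⟩ := PrimeSpectrum.exists_idempotent_basicOpen_eq_of_isClopen
    (isClopen_discrete {x})
  obtain ⟨a, rfl⟩ := Ideal.Quotient.mk_surjective e
  obtain ⟨b, hb, hba⟩ := exists_isIdempotentElem_sub_mem I (a := a)
    (by rw [← Ideal.Quotient.eq, map_mul]; exact he)
  rw [← Ideal.Quotient.eq] at hba
  rcases IsIdempotentElem.iff_eq_zero_or_one.mp hb with rfl | rfl
  · rw [← hba] at hxe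
    have : x ∈ ({x} : Set (PrimeSpectrum (B ⧸ I))) := rfl
    rw [hxe] at this
    simp at this
  · rw [← hba] at hxe
    have : y ∈ ({x} : Set (PrimeSpectrum (B ⧸ I))) := by rw [hxe]; simp
    exact (Set.mem_singleton_iff.mp this).symm

/-- A local ring that is finite over a complete Noetherian local ring is complete. -/
theorem isAdicComplete_maximalIdeal_of_finite (R B : Type*) [CommRing R] [IsLocalRing R]
    [IsNoetherianRing R] [IsAdicComplete (IsLocalRing.maximalIdeal R) R] [CommRing B]
    [IsLocalRing B] [Algebra R B] [Module.Finite R B] :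
    IsAdicComplete (IsLocalRing.maximalIdeal B) B := by
  let I := (IsLocalRing.maximalIdeal R).map (algebraMap R B)
  have : IsAdicComplete I B := isAdicComplete_map_maximalIdeal R B
  have hI : I ≤ IsLocalRing.maximalIdeal B :=
    ((IsAdicComplete.le_jacobson_bot I).trans (sInf_le ⟨bot_le, inferInstance⟩))
  -- By integrality, a prime containing `I` lies over the maximal ideal of `R` and is therefore
  -- maximal. Noetherianity then puts a power of the maximal ideal inside `I`.
  have hr : IsLocalRing.maximalIdeal B ≤ I.radical := by
    rw [Ideal.radical_eq_sInf]
    refine le_sInf fun P ⟨hIP, hP⟩ ↦ ?_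
    have hcomap : (P.comap (algebraMap R B)) = IsLocalRing.maximalIdeal R :=
      ((IsLocalRing.maximalIdeal.isMaximal R).eq_of_le
        (Ideal.IsPrime.comap (algebraMap R B)).ne_top (Ideal.map_le_iff_le_comap.mp hIP)).symm
    have : P.IsMaximal := Ideal.isMaximal_of_isIntegral_of_isMaximal_comap (R := R) P
      (hcomap ▸ IsLocalRing.maximalIdeal.isMaximal R)
    exact (IsLocalRing.eq_maximalIdeal this).ge
  have : IsNoetherianRing B := IsNoetherianRing.of_finite R B
  obtain ⟨e, he⟩ := Ideal.exists_radical_pow_le_of_fg I (IsNoetherian.noetherian _)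
  exact isAdicComplete_of_pow_le I _ hI ((Ideal.pow_right_mono hr e).trans he)

end Completeness

/-! ### Equivariant lifting by averaging -/

section EquivariantLift

variable {R A B C G : Type*} [CommRing R] [CommRing A] [CommRing B] [CommRing C] [Algebra R A]
  [Algebra R B] [Algebra R C]

/-- The average of ring homomorphisms that are congruent modulo an ideal of square zero is a ring
homomorphism. -/
theorem exists_algHom_eq_average {ι : Type*} [Fintype ι] (F : ι → (A →ₐ[R] B)) (f : A →ₐ[R] B)
    (hF : ∀ i j a b, (F i a - f a) * (F j b - f b) = 0) {v : B} (hv : v * Fintype.card ι = 1) :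
    ∃ F' : A →ₐ[R] B, ∀ a, F' a = v * ∑ i, F i a := by
  -- The mean difference `D` is a derivation along `f` whose values multiply to zero, so `f + D` is
  -- multiplicative.
  let D (a : A) : B := v * ∑ i, (F i a - f a)
  have hD (a : A) : v * ∑ i, F i a = f a + D a := by
    simp only [D, Finset.sum_sub_distrib, mul_sub, Finset.sum_const, Finset.card_univ,
      nsmul_eq_mul, ← mul_assoc, hv]
    ring
  have hDD (a b : A) : D a * D b = 0 := by
    simp only [D]
    rw [mul_mul_mul_comm, Finset.sum_mul_sum]
    simp [hF]
  have hDmul (a b : A) : D (a * b) = f a * D b + D a * f b := by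
    have (i : ι) : F i (a * b) - f (a * b) = f a * (F i b - f b) + (F i a - f a) * f b := by
      have := hF i i a b
      rw [map_mul, map_mul]
      linear_combination this
    simp only [D, this, Finset.sum_add_distrib, ← Finset.mul_sum, ← Finset.sum_mul]
    ring
  refine ⟨{ toFun := fun a ↦ v * ∑ i, F i a, map_one' := ?_, map_mul' := fun a b ↦ ?_,
            map_zero' := ?_, map_add' := fun a b ↦ ?_, commutes' := fun r ↦ ?_ }, fun a ↦ rfl⟩
  · simp [hv]
  · rw [hD, hD, hD, hDmul, map_mul]
    linear_combination -hDD a b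
  · simp
  · simp [Finset.sum_add_distrib, mul_add]
  · simp only [AlgHom.commutes, Finset.sum_const, Finset.card_univ, nsmul_eq_mul, ← mul_assoc, hv,
      one_mul]

theorem map_mul_ringHom_apply [Group G] {D : Type*} [CommRing D] (d : G →* (D →+* D)) (g h : G)
    (x : D) : d (g * h) x = d g (d h x) := by
  rw [map_mul]
  rfl

/-- Equivariant infinitesimal lifting, for a finite group of order prime to the residue
characteristic. -/
theorem exists_equivariant_lift_of_sq_eq_bot [Group G] [Finite G] [Algebra.FormallySmooth R A]
    (r : G →* (R →+* R)) (a : G →* (A →+* A)) (b : G →* (B →+* B)) (c : G →* (C →+* C))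
    (ha : ∀ g x, a g (algebraMap R A x) = algebraMap R A (r g x))
    (hb : ∀ g x, b g (algebraMap R B x) = algebraMap R B (r g x))
    (q : B →ₐ[R] C) (hq : Function.Surjective q) (hqb : ∀ g x, q (b g x) = c g (q x))
    (hker : ∀ x y, q x = 0 → q y = 0 → x * y = 0) (hG : IsUnit (Nat.card G : B))
    (f : A →ₐ[R] C) (hf : ∀ g x, f (a g x) = c g (f x)) :
    ∃ f' : A →ₐ[R] B, (∀ x, q (f' x) = f x) ∧ ∀ g x, f' (a g x) = b g (f' x) := by
  have hnil : IsNilpotent (RingHom.ker (q : B →+* C)) := by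
    refine ⟨2, ?_⟩
    rw [sq, Ideal.zero_eq_bot, eq_bot_iff, Ideal.mul_le]
    exact fun x hx y hy ↦ hker x y hx hy
  let f₀ : A →ₐ[R] B := Algebra.FormallySmooth.liftOfSurjective f q hq hnil
  have hf₀ (x : A) : q (f₀ x) = f x := Algebra.FormallySmooth.liftOfSurjective_apply f q hq hnil x
  have : Fintype G := Fintype.ofFinite G
  obtain ⟨v, hv⟩ := hG.exists_left_inv
  -- The conjugate `g ∘ f₀ ∘ g⁻¹` is `R`-linear although `g` is only semilinear, since the two
  -- twists cancel. It lifts `f` because `f` is equivariant.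
  let F (g : G) : A →ₐ[R] B :=
    { toRingHom := (b g).comp ((f₀ : A →+* B).comp (a g⁻¹))
      commutes' := fun x ↦ by
        change b g (f₀ (a g⁻¹ (algebraMap R A x))) = _
        rw [ha, AlgHom.commutes, hb, ← map_mul_ringHom_apply, mul_inv_cancel, map_one]
        rfl }
  have hFdef (g : G) (x : A) : F g x = b g (f₀ (a g⁻¹ x)) := rfl
  have hqF (g : G) (x : A) : q (F g x) = f x := by
    rw [hFdef, hqb, hf₀, ← hf, ← map_mul_ringHom_apply, mul_inv_cancel, map_one]
    rfl
  obtain ⟨F', hF'⟩ := exists_algHom_eq_average F f₀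
    (fun i j x y ↦ hker _ _ (by rw [map_sub, hqF, hf₀, sub_self])
      (by rw [map_sub, hqF, hf₀, sub_self])) (v := v) (by rwa [← Nat.card_eq_fintype_card])
  refine ⟨F', fun x ↦ ?_, fun g x ↦ ?_⟩
  · have := congrArg q hv
    rw [map_mul, map_natCast, map_one, Nat.card_eq_fintype_card] at this
    rw [hF', map_mul, map_sum]
    simp only [hqF, Finset.sum_const, Finset.card_univ, nsmul_eq_mul, ← mul_assoc, this, one_mul]
  · have hbv : b g v = v := by
      have h := congrArg (b g) hv
      rw [map_mul, map_natCast, map_one] at h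
      exact left_inv_eq_right_inv h (by rwa [mul_comm])
    rw [hF', hF', map_mul, hbv, map_sum]
    congr 1
    -- Left translation by `g` permutes the conjugates, so their average is equivariant.
    refine (Fintype.sum_equiv (Equiv.mulLeft g) _ _ fun h ↦ ?_).symm
    rw [Equiv.coe_mulLeft, hFdef, hFdef, mul_inv_rev, map_mul_ringHom_apply b,
      map_mul_ringHom_apply a, ← map_mul_ringHom_apply a g⁻¹ g, inv_mul_cancel, map_one]
    rfl

/-- The action on `B ⧸ I ^ n` induced by an action on `B` that preserves `I`. -/
def quotientPowAction [Group G] (b : G →* (B →+* B)) (I : Ideal B)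
    (hI : ∀ g, I ≤ I.comap (b g)) (n : ℕ) : G →* (B ⧸ I ^ n →+* B ⧸ I ^ n) where
  toFun g := Ideal.quotientMap (I ^ n) (b g)
    ((Ideal.pow_right_mono (hI g) n).trans (Ideal.le_comap_pow (b g) n))
  map_one' := by
    apply Ideal.Quotient.ringHom_ext
    ext x
    simp
  map_mul' g h := by
    apply Ideal.Quotient.ringHom_ext
    ext x
    simp

theorem quotientPowAction_mk [Group G] (b : G →* (B →+* B)) (I : Ideal B)
    (hI : ∀ g, I ≤ I.comap (b g)) (n : ℕ) (g : G) (x : B) :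
    quotientPowAction b I hI n g (Ideal.Quotient.mk _ x) = Ideal.Quotient.mk _ (b g x) := rfl

/-- Equivariant lifting from the residue ring of a complete ring. -/
theorem exists_equivariant_lift_of_isAdicComplete [Group G] [Finite G]
    [Algebra.FormallySmooth R A] (r : G →* (R →+* R)) (a : G →* (A →+* A)) (b : G →* (B →+* B))
    (ha : ∀ g x, a g (algebraMap R A x) = algebraMap R A (r g x))
    (hb : ∀ g x, b g (algebraMap R B x) = algebraMap R B (r g x))
    (I : Ideal B) [IsAdicComplete I B] (hI : ∀ g, I ≤ I.comap (b g))
    (hG : IsUnit (Nat.card G : B)) (f : A →ₐ[R] B ⧸ I)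
    (hf : ∀ g x y, f x = Ideal.Quotient.mk I y → f (a g x) = Ideal.Quotient.mk I (b g y)) :
    ∃ f' : A →ₐ[R] B, (∀ x, Ideal.Quotient.mk I (f' x) = f x) ∧
      ∀ g x, f' (a g x) = b g (f' x) := by
  let Q (n : ℕ) := {h : A →ₐ[R] B ⧸ I ^ n // ∀ g x, h (a g x) = quotientPowAction b I hI n g (h x)}
  let tr (n : ℕ) : B ⧸ I ^ (n + 1) →ₐ[R] B ⧸ I ^ n :=
    Ideal.Quotient.factorₐ R (Ideal.pow_le_pow_right n.le_succ)
  -- The kernel `I ^ n / I ^ (n + 1)` of `tr n` has square zero because `n + 1 ≤ 2n`; this is where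
  -- `1 ≤ n` enters.
  have step (n : ℕ) (hn : 1 ≤ n) (h : Q n) : ∃ h' : Q (n + 1), ∀ x, tr n (h'.1 x) = h.1 x := by
    obtain ⟨h', h₁, h₂⟩ := exists_equivariant_lift_of_sq_eq_bot r a
      (quotientPowAction b I hI (n + 1)) (quotientPowAction b I hI n) ha
      (fun g x ↦ congrArg (Ideal.Quotient.mk _) (hb g x)) (tr n)
      (Ideal.Quotient.factor_surjective (Ideal.pow_le_pow_right n.le_succ))
      (fun g x ↦ by obtain ⟨x, rfl⟩ := Ideal.Quotient.mk_surjective x; rfl)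
      (fun x y hx hy ↦ by
        obtain ⟨x, rfl⟩ := Ideal.Quotient.mk_surjective x
        obtain ⟨y, rfl⟩ := Ideal.Quotient.mk_surjective y
        replace hx : x ∈ I ^ n := Ideal.Quotient.eq_zero_iff_mem.mp hx
        replace hy : y ∈ I ^ n := Ideal.Quotient.eq_zero_iff_mem.mp hy
        rw [← map_mul, Ideal.Quotient.eq_zero_iff_mem]
        refine Ideal.pow_le_pow_right (show n + 1 ≤ n + n by lia) ?_
        rw [pow_add]
        exact Ideal.mul_mem_mul hx hy)
      (by simpa using hG.map (Ideal.Quotient.mk (I ^ (n + 1)))) h.1 h.2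
    exact ⟨⟨h', h₂⟩, h₁⟩
  choose next hnext using step
  have e1 : I ≤ I ^ 1 := (pow_one I).ge
  let f₁ : Q 1 := ⟨(Ideal.Quotient.factorₐ R e1).comp f, fun g x ↦ by
    obtain ⟨y, hy⟩ := Ideal.Quotient.mk_surjective (f x)
    rw [AlgHom.comp_apply, AlgHom.comp_apply, hf g x y hy.symm, ← hy]
    rfl⟩
  let F : (n : ℕ) → Q (n + 1) := fun n ↦ Nat.rec f₁ (fun n h ↦ next (n + 1) (by lia) h) n
  have hFs (n : ℕ) (x : A) : tr (n + 1) ((F (n + 1)).1 x) = (F n).1 x :=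
    hnext (n + 1) (by lia) (F n) x
  -- `F n` lives modulo `I ^ (n + 1)`; truncation gives a compatible system indexed from `0`.
  let F' (n : ℕ) : A →ₐ[R] B ⧸ I ^ n := (tr n).comp (F n).1
  have hcomp {m n : ℕ} (hmn : m ≤ n) :
      (Ideal.Quotient.factorₐ R (Ideal.pow_le_pow_right hmn)).comp (F' n) = F' m := by
    induction n, hmn using Nat.le_induction with
    | base =>
      ext x
      obtain ⟨y, hy⟩ := Ideal.Quotient.mk_surjective (F' m x)
      rw [AlgHom.comp_apply, ← hy]
      rfl
    | succ n hmn ih =>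
      rw [← ih]
      ext x
      have : F' n x = tr n (F' (n + 1) x) := by
        rw [AlgHom.comp_apply, AlgHom.comp_apply, hFs]
      rw [AlgHom.comp_apply, AlgHom.comp_apply (Ideal.Quotient.factorₐ R _) (F' n) x, this]
      obtain ⟨y, hy⟩ := Ideal.Quotient.mk_surjective (F' (n + 1) x)
      rw [← hy]
      rfl
  refine ⟨IsAdicComplete.liftAlgHom I F' hcomp, fun x ↦ ?_, fun g x ↦ ?_⟩
  · have h1 := IsAdicComplete.mk_liftAlgHom I F' hcomp 1 x
    have h2 : F' 1 x = f₁.1 x := hFs 0 x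
    rw [h2] at h1
    have h3 := congrArg (Ideal.Quotient.factorₐ R (pow_one I).le) h1
    obtain ⟨y, hy⟩ := Ideal.Quotient.mk_surjective (f x)
    have h4 : f₁.1 x = Ideal.Quotient.mk _ y := by
      change Ideal.Quotient.factorₐ R e1 (f x) = _
      rw [← hy]
      rfl
    rw [h4] at h3
    rw [← hy]
    exact h3
  -- As `B` is separated, equivariance of the limit can be checked modulo each `I ^ n`.
  · rw [IsHausdorff.eq_iff_smodEq (I := I)]
    intro n
    rw [smodEq_pow_iff, ← Ideal.Quotient.eq, IsAdicComplete.mk_liftAlgHom,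
      ← quotientPowAction_mk b I hI, IsAdicComplete.mk_liftAlgHom]
    change tr n ((F n).1 (a g x)) = quotientPowAction b I hI n g (tr n ((F n).1 x))
    rw [(F n).2]
    obtain ⟨y, hy⟩ := Ideal.Quotient.mk_surjective ((F n).1 x)
    rw [← hy]
    rfl

end EquivariantLift

/-! ### The ring of integers, its invariants and its residue field -/

section IntegralClosure

/-- Integrality makes the kernel of `h` maximal, so `h` factors through the residue field of `O`.
Then `κ` is algebraic over an algebraically closed field, hence equal to it. -/
theorem surjective_of_isIntegral_of_isAlgClosed {O κ : Type*} [CommRing O] [IsLocalRing O]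
    [IsAlgClosed (IsLocalRing.ResidueField O)] [Field κ] (h : O →+* κ) (hint : h.IsIntegral) :
    Function.Surjective h := by
  have hmax : (RingHom.ker h).IsMaximal := by
    have := Ideal.isMaximal_comap_of_isIntegral_of_isMaximal' h hint (⊥ : Ideal κ)
    rwa [← RingHom.ker_eq_comap_bot] at this
  have : IsLocalHom h := by
    refine ⟨fun a ha ↦ ?_⟩
    by_contra hna
    have : a ∈ RingHom.ker h := by
      rw [IsLocalRing.eq_maximalIdeal hmax]
      exact hna
    rw [RingHom.mem_ker.mp this] at ha
    exact not_isUnit_zero ha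
  let h' : IsLocalRing.ResidueField O →+* κ := IsLocalRing.ResidueField.lift h
  have hh' : h'.comp (IsLocalRing.residue O) = h := IsLocalRing.ResidueField.lift_comp_residue h
  have hint' : h'.IsIntegral := by
    refine RingHom.IsIntegral.tower_top (IsLocalRing.residue O) h' ?_
    rwa [hh']
  rw [← hh']
  let := h'.toAlgebra
  have : Algebra.IsIntegral (IsLocalRing.ResidueField O) κ := ⟨hint'⟩
  exact (IsAlgClosed.algebraMap_bijective_of_isIntegral (k := IsLocalRing.ResidueField O)
    (K := κ)).2.comp IsLocalRing.residue_surjective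

theorem natCast_ne_zero_of_coprime_ringExpChar {k : Type*} [Field k] {n : ℕ} (hn : n ≠ 0)
    (h : n.Coprime (ringExpChar k)) : (n : k) ≠ 0 := by
  have := ringExpChar.expChar k
  generalize ringExpChar k = p at *
  cases this with
  | zero => exact_mod_cast hn
  | prime hp =>
    rw [Ne, CharP.cast_eq_zero_iff k p]
    exact (hp.coprime_iff_not_dvd.mp h.symm)

/-- The action of a group on a ring, as a homomorphism to the monoid of endomorphisms. -/
def actionHom (G A : Type*) [Group G] [CommRing A] [MulSemiringAction G A] : G →* (A →+* A) where
  toFun g := MulSemiringAction.toRingHom G A g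
  map_one' := by ext; simp
  map_mul' g h := by ext; simp [mul_smul]

theorem actionHom_apply (G A : Type*) [Group G] [CommRing A] [MulSemiringAction G A] (g : G)
    (a : A) : actionHom G A g a = g • a := rfl

theorem actionHom_mem_maximalIdeal {G B : Type*} [Group G] [CommRing B] [IsLocalRing B]
    [MulSemiringAction G B] (g : G) :
    IsLocalRing.maximalIdeal B ≤ (IsLocalRing.maximalIdeal B).comap (actionHom G B g) := by
  intro b hb hu
  refine hb ?_
  have := hu.map (actionHom G B g⁻¹)
  rwa [actionHom_apply, actionHom_apply, inv_smul_smul] at this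

/-- A field that is an algebra of finite type over a local ring `B`, with nonzero special fibre, is
a quotient of the complete ring `O`, provided that `B` is integral over `O` and the residue field of
`O` is algebraically closed. -/
theorem surjective_comp_algebraMap_of_finiteType {O B κ : Type*} [CommRing O] [IsLocalRing O]
    [IsAlgClosed (IsLocalRing.ResidueField O)] [CommRing B] [IsLocalRing B] [Algebra O B]
    [Algebra.IsIntegral O B] [Field κ] (h : B →+* κ) [IsLocalHom h] (hft : h.FiniteType) :
    Function.Surjective (h.comp (algebraMap O B)) := by
  let h' : IsLocalRing.ResidueField B →+* κ := IsLocalRing.ResidueField.lift h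
  have hh' : h'.comp (IsLocalRing.residue B) = h := IsLocalRing.ResidueField.lift_comp_residue h
  -- Zariski's lemma.
  have hfin : h'.Finite := by
    have : h'.FiniteType := RingHom.FiniteType.of_comp_finiteType (f := IsLocalRing.residue B)
      (hh'.symm ▸ hft)
    algebraize [h']
    exact finite_of_finite_type_of_isJacobsonRing (IsLocalRing.ResidueField B) κ
  have hint : h.IsIntegral := by
    rw [← hh']
    exact RingHom.IsIntegral.trans _ _
      (RingHom.isIntegral_of_surjective _ IsLocalRing.residue_surjective) hfin.to_isIntegral
  exact surjective_of_isIntegral_of_isAlgClosed _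
    (RingHom.IsIntegral.trans _ _ (algebraMap_isIntegral_iff.mpr inferInstance) hint)

theorem isUnit_natCast_of_coprime_ringExpChar {O : Type*} [CommRing O] [IsLocalRing O] {n : ℕ}
    (hn : n ≠ 0) (h : n.Coprime (ringExpChar (IsLocalRing.ResidueField O))) : IsUnit (n : O) := by
  by_contra hu
  refine natCast_ne_zero_of_coprime_ringExpChar hn h ?_
  rw [← map_natCast (IsLocalRing.residue O)]
  exact (IsLocalRing.residue_eq_zero_iff _).mpr hu

theorem smul_algebraMap_integralClosure (O K L : Type u) [CommRing O] [Field K] [Algebra O K]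
    [Field L] [Algebra K L] [Algebra O L] [IsScalarTower O K L] (g : Gal(L/K)) (x : O) :
    g • algebraMap O (integralClosure O L) x = algebraMap O (integralClosure O L) x := by
  apply Subtype.ext
  rw [coe_galoisActionIntegers]
  change g (algebraMap O L x) = algebraMap O L x
  rw [IsScalarTower.algebraMap_apply O K L, AlgEquiv.commutes]

theorem algebraMap_integralClosure_injective (O K L : Type u) [CommRing O] [IsDomain O] [Field K]
    [Algebra O K] [IsFractionRing O K] [Field L] [Algebra K L] [Algebra O L]
    [IsScalarTower O K L] : Function.Injective (algebraMap O (integralClosure O L)) := by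
  have : FaithfulSMul O L := by
    rw [faithfulSMul_iff_algebraMap_injective, IsScalarTower.algebraMap_eq O K L]
    exact (algebraMap K L).injective.comp (IsFractionRing.injective O K)
  exact FaithfulSMul.algebraMap_injective O (integralClosure O L)

theorem finite_integralClosure (O K L : Type u) [CommRing O] [IsDomain O]
    [IsDiscreteValuationRing O] [Field K] [Algebra O K] [IsFractionRing O K] [Field L] [Algebra K L]
    [Algebra O L] [IsScalarTower O K L] [FiniteDimensional K L] [IsGalois K L] :
    Module.Finite O (integralClosure O L) :=
  IsIntegralClosure.finite O K L (integralClosure O L)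

/-- By Galois theory a fixed element lies in `K`; it is integral over `O`, and a discrete valuation
ring is integrally closed. -/
theorem exists_algebraMap_eq_of_smul_eq {O K L : Type u} [CommRing O] [IsDomain O]
    [IsDiscreteValuationRing O] [Field K] [Algebra O K] [IsFractionRing O K] [Field L] [Algebra K L]
    [Algebra O L] [IsScalarTower O K L] [FiniteDimensional K L] [IsGalois K L]
    (b : integralClosure O L) (hb : ∀ g : Gal(L/K), g • b = b) :
    ∃ a : O, algebraMap O (integralClosure O L) a = b := by
  obtain ⟨c, hc⟩ := (IsGalois.mem_range_algebraMap_iff_fixed (F := K) (b : L)).mpr fun g ↦ by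
    rw [← coe_galoisActionIntegers O K L, hb]
  have hint : IsIntegral O c := by
    have := b.2
    rw [← hc] at this
    exact (isIntegral_algebraMap_iff (algebraMap K L).injective).mp this
  obtain ⟨a, ha⟩ := IsIntegrallyClosed.isIntegral_iff.mp hint
  refine ⟨a, Subtype.ext ?_⟩
  rw [← hc, ← ha]
  exact IsScalarTower.algebraMap_apply O K L a

/-- If `L ≠ K`, then a point of `Spec 𝒪_L` that is fixed by the Galois group, with trivial action on
the residue field, is the closed point. -/
theorem isLocalHom_of_smul_invariant {O K L κ : Type u} [CommRing O] [IsDomain O]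
    [IsDiscreteValuationRing O] [Field K] [Algebra O K] [IsFractionRing O K] [Field L] [Algebra K L]
    [Algebra O L] [IsScalarTower O K L] [FiniteDimensional K L] [IsGalois K L]
    [IsLocalRing (integralClosure O L)] (hLK : 1 < Module.finrank K L) [Field κ]
    (h : integralClosure O L →+* κ) (hinv : ∀ (g : Gal(L/K)) b, h (g • b) = h b) :
    IsLocalHom h := by
  have : IsFractionRing (integralClosure O L) L :=
    IsIntegralClosure.isFractionRing_of_finite_extension O K L (integralClosure O L)
  have : IsDedekindDomain (integralClosure O L) := integralClosure.isDedekindDomain O K L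
  -- If `h` were injective, the Galois group would act trivially on `𝒪_L`, hence on its fraction
  -- field `L`, against `L ≠ K`.
  have hker : RingHom.ker h ≠ ⊥ := fun hbot ↦ by
    have hinj : Function.Injective h := (RingHom.injective_iff_ker_eq_bot h).mpr hbot
    have htriv (g : Gal(L/K)) : g = 1 := by
      ext l
      obtain ⟨a, b, hb, rfl⟩ := IsFractionRing.div_surjective (A := integralClosure O L) l
      have hg (x : integralClosure O L) : g (x : L) = x := by
        rw [← coe_galoisActionIntegers O K L, hinj (hinv g x)]
      rw [map_div₀]
      change g (a : L) / g (b : L) = (a : L) / (b : L)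
      rw [hg, hg]
    have : Subsingleton Gal(L/K) := ⟨fun g g' ↦ (htriv g).trans (htriv g').symm⟩
    rw [← IsGalois.card_aut_eq_finrank, Nat.card_unique] at hLK
    exact lt_irrefl _ hLK
  have hmax : (RingHom.ker h).IsMaximal :=
    Ring.DimensionLEOne.maximalOfPrime hker (RingHom.ker_isPrime h)
  refine ⟨fun a ha ↦ ?_⟩
  by_contra hna
  have : a ∈ RingHom.ker h := by
    rw [IsLocalRing.eq_maximalIdeal hmax]
    exact hna
  rw [RingHom.mem_ker.mp this] at ha
  exact not_isUnit_zero ha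

end IntegralClosure
-- Morphisms from local schemes, and local rings
section Stalks

open IsLocalRing

/-- A morphism from the spectrum of a local ring factors through the spectrum of the local ring at
the image of the closed point. -/
theorem exists_spec_map_comp_fromSpecStalk {X : Scheme.{u}} {R : CommRingCat.{u}} [IsLocalRing R]
    (f : Spec R ⟶ X) (x : X) (hx : f (closedPoint R) = x) :
    ∃ c : X.presheaf.stalk x ⟶ R, IsLocalHom c.hom ∧ Spec.map c ≫ X.fromSpecStalk x = f := by
  subst hx
  exact ⟨Scheme.stalkClosedPointTo f, inferInstance, Scheme.Spec_stalkClosedPointTo_fromSpecStalk f⟩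

theorem spec_map_comp_fromSpecStalk_injective {X : Scheme.{u}} {x : X} {R : CommRingCat.{u}}
    {c d : X.presheaf.stalk x ⟶ R}
    (h : Spec.map c ≫ X.fromSpecStalk x = Spec.map d ≫ X.fromSpecStalk x) : c = d :=
  Spec.map_injective ((cancel_mono _).mp h)

theorem comp_apply_closedPoint {X Y : Scheme.{u}} {R : CommRingCat.{u}} [IsLocalRing R]
    (f : Spec R ⟶ X) (g : X ⟶ Y) : (f ≫ g) (closedPoint R) = g (f (closedPoint R)) :=
  Scheme.Hom.comp_apply f g _

theorem spec_map_comp_fromSpecStalk_closedPoint {X : Scheme.{u}} {x : X} {R : CommRingCat.{u}}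
    [IsLocalRing R] (c : X.presheaf.stalk x ⟶ R) [IsLocalHom c.hom] :
    (Spec.map c ≫ X.fromSpecStalk x) (closedPoint R) = x := by
  rw [comp_apply_closedPoint, Spec_closedPoint, Scheme.fromSpecStalk_closedPoint]

/-- An endomorphism of a scheme acts on the local ring at a fixed point. -/
theorem exists_stalk_endomorphism {X : Scheme.{u}} (f : X ⟶ X) (x : X) (hx : f x = x) :
    ∃ τ : X.presheaf.stalk x ⟶ X.presheaf.stalk x,
      Spec.map τ ≫ X.fromSpecStalk x = X.fromSpecStalk x ≫ f := by
  obtain ⟨τ, -, hτ⟩ := exists_spec_map_comp_fromSpecStalk (X.fromSpecStalk x ≫ f) x (by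
    rw [comp_apply_closedPoint, Scheme.fromSpecStalk_closedPoint, hx])
  exact ⟨τ, hτ⟩

/-- Since `i` is local, `s` and `s'` agree at the closed point, so both factor through the same
local ring of `X`. There injectivity of `i` decides. It gives the uniqueness of the descended
section. -/
theorem eq_of_spec_map_comp_eq {X : Scheme.{u}} {R R' : CommRingCat.{u}} [IsLocalRing R]
    [IsLocalRing R'] (i : R ⟶ R') [IsLocalHom i.hom] (hi : Function.Injective i.hom)
    {s s' : Spec R ⟶ X} (h : Spec.map i ≫ s = Spec.map i ≫ s') : s = s' := by
  have hcl (t : Spec R ⟶ X) : (Spec.map i ≫ t) (closedPoint R') = t (closedPoint R) := by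
    rw [comp_apply_closedPoint, Spec_closedPoint]
  obtain ⟨c, -, hc⟩ := exists_spec_map_comp_fromSpecStalk s (s (closedPoint R)) rfl
  obtain ⟨d, -, hd⟩ := exists_spec_map_comp_fromSpecStalk s' (s (closedPoint R))
    (by rw [← hcl, ← h, hcl])
  rw [← hc, ← hd, ← Spec.map_comp_assoc, ← Spec.map_comp_assoc] at h
  have := spec_map_comp_fromSpecStalk_injective h
  have hcd : c = d := by
    ext x
    exact hi congr($this x)
  rw [← hc, ← hd, hcd]

/-- A morphism from the spectrum of a local ring descends to the spectrum of the subring of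
invariants. -/
theorem exists_spec_map_comp_eq_of_invariant {X : Scheme.{u}} {R R' : CommRingCat.{u}}
    [IsLocalRing R'] (i : R ⟶ R') (hi : Function.Injective i.hom) {ι : Type*}
    (β : ι → (R' ⟶ R')) (hβ : ∀ x, (∀ j, β j x = x) → ∃ a, i a = x)
    (f : Spec R' ⟶ X) (hf : ∀ j, Spec.map (β j) ≫ f = f) :
    ∃ s : Spec R ⟶ X, Spec.map i ≫ s = f := by
  obtain ⟨c, -, hc⟩ := exists_spec_map_comp_fromSpecStalk f _ rfl
  generalize f (closedPoint R') = x at c hc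
  subst hc
  -- The map from the local ring is unique because `fromSpecStalk` is a monomorphism, so invariance
  -- of `f` passes to `c`.
  have hcβ (j : ι) : c ≫ β j = c := by
    refine spec_map_comp_fromSpecStalk_injective ?_
    rw [Spec.map_comp, Category.assoc, hf]
  have hrange (y : X.presheaf.stalk x) : c y ∈ i.hom.range :=
    hβ (c y) fun j ↦ congr($(hcβ j) y)
  let e := RingEquiv.ofBijective i.hom.rangeRestrict
    ⟨fun a b hab ↦ hi (congrArg Subtype.val hab), i.hom.rangeRestrict_surjective⟩
  let d : X.presheaf.stalk x ⟶ R :=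
    CommRingCat.ofHom (e.symm.toRingHom.comp (c.hom.codRestrict i.hom.range hrange))
  have hd : d ≫ i = c := by
    ext y
    exact congrArg Subtype.val (e.apply_symm_apply ⟨c y, hrange y⟩)
  exact ⟨Spec.map d ≫ X.fromSpecStalk x, by rw [← Spec.map_comp_assoc, hd]⟩

/-- The local rings of a smooth scheme over an affine base are formally smooth over the base. -/
theorem formallySmooth_of_spec_map_eq {X : Scheme.{u}} {B : CommRingCat.{u}} (f : X ⟶ Spec B)
    [Smooth f] (x : X) (ψ : B ⟶ X.presheaf.stalk x)
    (hψ : Spec.map ψ = X.fromSpecStalk x ≫ f) : ψ.hom.FormallySmooth := by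
  have h1 : (f.stalkMap x).hom.FormallySmooth := by
    rw [← Scheme.Hom.mem_smoothLocus, Scheme.Hom.smoothLocus_eq_top]
    trivial
  -- Factor `ψ` as the localization of `B` at `f x` followed by the stalk map of `f`; both are
  -- formally smooth.
  have h2 : ψ = StructureSheaf.toStalk B (f x) ≫ f.stalkMap x := by
    apply Spec.map_injective
    rw [hψ, ← Scheme.SpecMap_stalkMap_fromSpecStalk, Spec.fromSpecStalk_eq']
    exact (Spec.map_comp _ _).symm
  have h3 : (StructureSheaf.toStalk B (f x)).hom.FormallySmooth := by
    let p : PrimeSpectrum B := f x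
    have : Algebra.FormallySmooth B ((Spec.structureSheaf B).presheaf.stalk p) :=
      Algebra.FormallySmooth.of_isLocalization p.asIdeal.primeCompl
    exact RingHom.formallySmooth_algebraMap.mpr this
  rw [h2]
  exact h3.comp h1

/-- A point of a scheme over an affine scheme whose coordinate ring surjects onto its residue field
is closed. -/
theorem isClosed_singleton_of_surjective {X : Scheme.{u}} {B κ : CommRingCat.{u}}
    [Subsingleton (Spec κ)]
    (f : X ⟶ Spec B) (z : Spec κ ⟶ X) (h : B ⟶ κ) (hh : Spec.map h = z ≫ f)
    (hsurj : Function.Surjective h.hom) (t : Spec κ) : IsClosed {z t} := by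
  -- `X` need not be separated, so closedness is tested on affine opens `V`. Those are separated
  -- over `B`, so if `z` lands in `V`, it is a closed immersion there because its composite to `Spec
  -- B` is one.
  rw [TopologicalSpace.IsOpenCover.isClosed_iff_coe_preimage (iSup_affineOpens_eq_top X)]
  intro V
  by_cases hV : z t ∈ V.1
  · have hrange : Set.range z ⊆ Set.range V.1.ι := by
      rintro _ ⟨t', rfl⟩
      rw [Scheme.Opens.range_ι, Subsingleton.elim t' t]
      exact hV
    let z' := IsOpenImmersion.lift V.1.ι z hrange
    have hz' : z' ≫ V.1.ι = z := IsOpenImmersion.lift_fac _ _ _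
    have : IsClosedImmersion (z' ≫ V.1.ι ≫ f) := by
      rw [← Category.assoc, hz', ← hh]
      exact IsClosedImmersion.spec_of_surjective h hsurj
    have : IsAffine V.1 := V.2
    have : IsClosedImmersion z' := IsClosedImmersion.of_comp z' (V.1.ι ≫ f)
    convert! z'.isClosedEmbedding.isClosed_range using 1
    ext v
    have hv : ((v : X) = z t) ↔ v = z' t := by
      rw [← hz', Scheme.Hom.comp_apply]
      exact Subtype.ext_iff.symm
    refine hv.trans ⟨fun h ↦ ⟨t, h.symm⟩, fun ⟨t', ht'⟩ ↦ ?_⟩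
    rw [← ht', Subsingleton.elim t' t]
  · convert isClosed_empty
    ext v
    simp only [Set.mem_preimage, Set.mem_singleton_iff, Set.mem_empty_iff_false, iff_false]
    intro hv
    exact hV (hv ▸ v.2)

end Stalks

/-! ### The fixed locus as a subscheme -/

section FixedLocus

variable {G : Type u} [Group G] [Finite G] {Y : Scheme.{u}} (ρ : G →* Aut Y)

/-- The inclusion is a base change of a diagonal, which is an immersion, though not necessarily a
closed one when the target is not separated. -/
theorem isImmersion_equalizer_ι {X Y : Scheme.{u}} (f g : X ⟶ Y) :
    IsImmersion (equalizer.ι f g) :=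
  inferInstance

theorem isImmersion_fixedLocusι : IsImmersion (fixedLocusι ρ) := by
  unfold fixedLocusι
  exact isImmersion_equalizer_ι _ _

end FixedLocus

/-! ### Equivariance of the structure morphism of a model -/

section Equivariance

theorem flat_specMap_of_isLocalization {A B : Type u} [CommRing A] [CommRing B] [Algebra A B]
    (M : Submonoid A) [IsLocalization M B] :
    Flat (Spec.map (CommRingCat.ofHom (algebraMap A B))) := by
  rw [Flat.SpecMap_iff]
  exact RingHom.flat_algebraMap_iff.mpr (IsLocalization.flat B M)

/-- Generalizations lift along a flat morphism, so a nonempty image contains the generic point. -/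
theorem isDominant_of_flat {X Y : Scheme.{u}} [Nonempty X] [IsIntegral Y] (f : X ⟶ Y) [Flat f] :
    IsDominant f := by
  obtain ⟨x⟩ := ‹Nonempty X›
  have hη : genericPoint Y ∈ Set.range f :=
    (Flat.generalizingMap f).stableUnderGeneralization_range
      (genericPoint_specializes (f x)) ⟨x, rfl⟩
  refine ⟨fun y ↦ ?_⟩
  exact (genericPoint_specializes y).mem_closed isClosed_closure (subset_closure hη)

theorem specAction_comp_specMap_algebraMap (O K L : Type u) [CommRing O] [Field K] [Algebra O K]
    [Field L] [Algebra K L] [Algebra O L] [IsScalarTower O K L] (g : Gal(L/K)) :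
    (specAction Gal(L/K) L g).hom ≫
        Spec.map (CommRingCat.ofHom (algebraMap (integralClosure O L) L)) =
      Spec.map (CommRingCat.ofHom (algebraMap (integralClosure O L) L)) ≫
        (galoisActionT O K L g).hom := by
  change Spec.map _ ≫ Spec.map _ = Spec.map _ ≫ Spec.map _
  rw [← Spec.map_comp, ← Spec.map_comp, ← CommRingCat.ofHom_comp, ← CommRingCat.ofHom_comp]
  congr 1

/-- The structure morphism of a model is equivariant if it is so on the generic fibre. -/
theorem isEquivariant_of_isModel {O K L : Type u} [CommRing O] [IsDomain O] [Field K] [Algebra O K]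
    [IsFractionRing O K] [Field L] [Algebra K L] [Algebra O L] [IsScalarTower O K L]
    [FiniteDimensional K L] {X : Scheme.{u}} (p : X ⟶ Spec (.of K)) (hX : IsVariety p)
    {Y : Scheme.{u}} (φ : Y ⟶ specIntegers O L) (j : baseChange L p ⟶ Y)
    (hY : IsModel (pullback.snd p (specFieldMap K L)) φ j) (ρ : Gal(L/K) →* Aut Y)
    (hj : IsEquivariant (galoisActionBaseChange L p) ρ j) :
    IsEquivariant ρ (galoisActionT O K L) φ := by
  have := hY.isIntegral
  have : IsFractionRing (integralClosure O L) L :=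
    IsIntegralClosure.isFractionRing_of_finite_extension O K L (integralClosure O L)
  have hflat := flat_specMap_of_isLocalization (B := L) (nonZeroDivisors (integralClosure O L))
  have : Flat j := MorphismProperty.of_isPullback (P := @Flat) hY.isPullback.flip hflat
  have := hX.geometricallyIntegral
  have : IsIntegral (baseChange L p) := GeometricallyIntegral.geometrically_isIntegral (f := p)
    (specFieldMap K L) (pullback.fst p _) (pullback.snd p _) (IsPullback.of_hasPullback _ _)
  have : IsDominant j := isDominant_of_flat j
  intro g
  -- The generic fibre is dominant in the reduced scheme `Y`, and `T` is separated, so it suffices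
  -- to compare the two morphisms on `X_L`.
  refine ext_of_isDominant (ι := j) ?_
  have hg : galoisHomBaseChange L p g ≫ j = j ≫ (ρ g).hom := hj g
  rw [← Category.assoc, ← hg, Category.assoc, ← Category.assoc j, hY.isPullback.w, ← Category.assoc,
    galoisHomBaseChange_snd, Category.assoc, Category.assoc, specAction_comp_specMap_algebraMap]

end Equivariance

/-! ### Closed fixed points and equivariant sections -/

section Sections

open IsLocalRing

/-- A fixed point of a model of a variety over `L ≠ K` lies in the special fibre. -/
theorem exists_isLocalHom_of_fixed {O K L : Type u} [CommRing O] [IsDomain O]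
    [IsDiscreteValuationRing O] [Field K] [Algebra O K] [IsFractionRing O K] [Field L] [Algebra K L]
    [Algebra O L] [IsScalarTower O K L] [FiniteDimensional K L] [IsGalois K L]
    [IsLocalRing (integralClosure O L)]
    (hLK : 1 < Module.finrank K L) {Y : Scheme.{u}} (φ : Y ⟶ specIntegers O L)
    (ρ : Gal(L/K) →* Aut Y) (hφ : IsEquivariant ρ (galoisActionT O K L) φ) {κ : Type u} [Field κ]
    (z : Spec (.of κ) ⟶ Y) (hz : ∀ g, z ≫ (ρ g).hom = z) :
    ∃ h : integralClosure O L →+* κ, Spec.map (CommRingCat.ofHom h) = z ≫ φ ∧ IsLocalHom h := by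
  obtain ⟨h, hh⟩ : ∃ h : integralClosure O L →+* κ, Spec.map (CommRingCat.ofHom h) = z ≫ φ :=
    ⟨(Spec.preimage (z ≫ φ)).hom, Spec.map_preimage (z ≫ φ)⟩
  refine ⟨h, hh, isLocalHom_of_smul_invariant hLK h fun g b ↦ ?_⟩
  -- `specAction` attaches `g⁻¹ •` to `g`; starting from `g⁻¹` yields invariance under `g •`.
  have h1 : (z ≫ φ) ≫ (galoisActionT O K L g⁻¹).hom = z ≫ φ := by
    rw [Category.assoc, ← hφ, ← Category.assoc, hz]
  rw [← hh] at h1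
  have h2 : CommRingCat.ofHom (MulSemiringAction.toRingHom Gal(L/K) (integralClosure O L) g⁻¹⁻¹) ≫
      CommRingCat.ofHom h = CommRingCat.ofHom h :=
    Spec.map_injective ((Spec.map_comp _ _).trans h1)
  have h3 := congr($h2 b)
  rwa [inv_inv] at h3

/-- A nonempty fixed locus contains a closed point of the model. -/
theorem exists_isClosed_mem_range_fixedLocusι {O K L : Type u} [CommRing O] [IsDomain O]
    [IsDiscreteValuationRing O] [Field K] [Algebra O K] [IsFractionRing O K] [Field L] [Algebra K L]
    [Algebra O L] [IsScalarTower O K L] [FiniteDimensional K L] [IsGalois K L]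
    [IsLocalRing (integralClosure O L)]
    [IsAlgClosed (ResidueField O)] (hLK : 1 < Module.finrank K L) {Y : Scheme.{u}}
    (φ : Y ⟶ specIntegers O L) [LocallyOfFiniteType φ] (ρ : Gal(L/K) →* Aut Y)
    (hφ : IsEquivariant ρ (galoisActionT O K L) φ) [Nonempty (fixedLocus ρ)] :
    ∃ y : Y, IsClosed {y} ∧ y ∈ Set.range (fixedLocusι ρ) := by
  obtain ⟨x⟩ := ‹Nonempty (fixedLocus ρ)›
  obtain ⟨_, ⟨W : (fixedLocus ρ).Opens, hW, rfl⟩, hxW, -⟩ :=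
    (fixedLocus ρ).isBasis_affineOpens.exists_subset_of_mem_open (Set.mem_univ x) isOpen_univ
  have : CompactSpace W := isCompact_iff_compactSpace.mp hW.isCompact
  -- A closed point of an affine open of `Y^G` need not be visibly closed in `Y`. Its residue field
  -- is of finite type over `𝒪_L`, hence a quotient of `O`, and this forces closedness in `Y`.
  obtain ⟨w, -, hw⟩ := IsClosed.exists_closed_singleton (S := (Set.univ : Set W)) isClosed_univ
    ⟨⟨x, hxW⟩, trivial⟩
  have := isClosed_singleton_iff_isClosedImmersion.mp hw
  have := isImmersion_fixedLocusι ρ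
  let z₀ : Spec (W.toScheme.residueField w) ⟶ fixedLocus ρ :=
    W.toScheme.fromSpecResidueField w ≫ W.ι
  obtain ⟨h, hh, hloc⟩ := exists_isLocalHom_of_fixed hLK φ ρ hφ
    (κ := W.toScheme.residueField w) (z₀ ≫ fixedLocusι ρ)
    fun g ↦ by rw [Category.assoc, fixedLocusι_comp]
  have hft : h.FiniteType := by
    have : LocallyOfFiniteType (Spec.map (CommRingCat.ofHom h)) := by
      rw [hh]
      infer_instance
    exact (HasRingHomProperty.Spec_iff (P := @LocallyOfFiniteType)).mp this
  have hsurj := surjective_comp_algebraMap_of_finiteType (O := O) h hft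
  rw [RingHom.coe_comp] at hsurj
  let t : Spec (W.toScheme.residueField w) := default
  refine ⟨(z₀ ≫ fixedLocusι ρ) t, ?_, z₀ t, (Scheme.Hom.comp_apply _ _ _).symm⟩
  exact isClosed_singleton_of_surjective φ (z₀ ≫ fixedLocusι ρ) _ hh hsurj.of_comp t

/-- The local ring at a fixed point carries an action of the group. -/
theorem exists_stalk_action {G : Type u} [Group G] {Y : Scheme.{u}} (ρ : G →* Aut Y) (y : Y)
    (hy : ∀ g, (ρ g).hom y = y) :
    ∃ a : G →* (Y.presheaf.stalk y →+* Y.presheaf.stalk y), ∀ g,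
      Spec.map (CommRingCat.ofHom (a g)) ≫ Y.fromSpecStalk y =
        Y.fromSpecStalk y ≫ (ρ g⁻¹).hom := by
  choose τ hτ using fun g ↦ exists_stalk_endomorphism (ρ g).hom y (hy g)
  -- Passing to local rings reverses composition; the inverse restores a left action.
  refine ⟨{ toFun := fun g ↦ (τ g⁻¹).hom, map_one' := ?_, map_mul' := fun g h ↦ ?_ },
    fun g ↦ hτ g⁻¹⟩
  · have : τ 1⁻¹ = 𝟙 _ := by
      refine spec_map_comp_fromSpecStalk_injective ?_
      rw [hτ, inv_one, map_one, Spec.map_id, Category.id_comp]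
      exact Category.comp_id _
    rw [this]
    rfl
  · have : τ (g * h)⁻¹ = τ h⁻¹ ≫ τ g⁻¹ := by
      refine spec_map_comp_fromSpecStalk_injective ?_
      rw [hτ, mul_inv_rev, map_mul, Spec.map_comp, Category.assoc, hτ, ← Category.assoc, hτ,
        Category.assoc]
      rfl
    rw [this]
    rfl

/-- Through every closed fixed point of a smooth model passes an equivariant section. -/
theorem exists_isEquivariant_section {O K L : Type u} [CommRing O] [IsDomain O]
    [IsDiscreteValuationRing O] [Field K] [Algebra O K] [IsFractionRing O K] [Field L] [Algebra K L]
    [Algebra O L] [IsScalarTower O K L] [FiniteDimensional K L] [IsGalois K L]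
    [IsLocalRing (integralClosure O L)]
    [IsAdicComplete (maximalIdeal (integralClosure O L)) (integralClosure O L)]
    [IsAlgClosed (ResidueField O)] (hTame : IsTame O K L) (hLK : 1 < Module.finrank K L)
    {Y : Scheme.{u}} (φ : Y ⟶ specIntegers O L) [Smooth φ] (ρ : Gal(L/K) →* Aut Y)
    (hφ : IsEquivariant ρ (galoisActionT O K L) φ) (y : Y) (hyc : IsClosed {y})
    (hy : y ∈ Set.range (fixedLocusι ρ)) :
    ∃ σ : specIntegers O L ⟶ Y, σ ≫ φ = 𝟙 _ ∧ IsEquivariant (galoisActionT O K L) ρ σ ∧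
      σ (closedPoint (integralClosure O L)) = y := by
  obtain ⟨w, rfl⟩ := hy
  set y : Y := fixedLocusι ρ w
  let ι := Y.fromSpecStalk y
  obtain ⟨a, ha⟩ := exists_stalk_action ρ y fun g ↦ by
    rw [← Scheme.Hom.comp_apply, fixedLocusι_comp]
  obtain ⟨ψ, hψ⟩ : ∃ ψ : integralClosure O L →+* Y.presheaf.stalk y,
      Spec.map (CommRingCat.ofHom ψ) = ι ≫ φ :=
    ⟨(Spec.preimage (ι ≫ φ)).hom, Spec.map_preimage (ι ≫ φ)⟩
  have haψ (g : Gal(L/K)) (b : integralClosure O L) : a g (ψ b) = ψ (g • b) := by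
    have h1 : CommRingCat.ofHom ψ ≫ CommRingCat.ofHom (a g) =
        CommRingCat.ofHom (MulSemiringAction.toRingHom Gal(L/K) (integralClosure O L) g⁻¹⁻¹) ≫
          CommRingCat.ofHom ψ := by
      apply Spec.map_injective
      rw [Spec.map_comp, Spec.map_comp, hψ, ← Category.assoc, ha, Category.assoc, hφ,
        ← Category.assoc]
      rfl
    have h2 := congr($h1 b)
    rwa [inv_inv] at h2
  -- the residue field at `w`
  let z : Spec ((fixedLocus ρ).residueField w) ⟶ Y :=
    (fixedLocus ρ).fromSpecResidueField w ≫ fixedLocusι ρ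
  have hz (g : Gal(L/K)) : z ≫ (ρ g).hom = z := by rw [Category.assoc, fixedLocusι_comp]
  obtain ⟨c, hcloc, hc⟩ := exists_spec_map_comp_fromSpecStalk z y (by
    rw [comp_apply_closedPoint]
    exact congrArg _ (Scheme.fromSpecResidueField_apply w _))
  obtain ⟨h₀, hh₀, hh₀loc⟩ := exists_isLocalHom_of_fixed hLK φ ρ hφ
    (κ := (fixedLocus ρ).residueField w) z hz
  have hcψ (b : integralClosure O L) : c (ψ b) = h₀ b := by
    have : CommRingCat.ofHom ψ ≫ c = CommRingCat.ofHom h₀ := by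
      apply Spec.map_injective
      rw [Spec.map_comp, hψ, ← Category.assoc, hc]
      exact hh₀.symm
    exact congr($this b)
  -- This uses that `z` is fixed as a morphism, which is stronger than `y` being a fixed point of
  -- the underlying space.
  have hca (g : Gal(L/K)) (x : Y.presheaf.stalk y) : c (a g x) = c x := by
    have : CommRingCat.ofHom (a g) ≫ c = c := by
      refine spec_map_comp_fromSpecStalk_injective ?_
      rw [Spec.map_comp, Category.assoc, ha, ← Category.assoc, hc, hz]
    exact congr($this x)
  -- the residue field at `y`
  let res : Y.presheaf.stalk y →+* Y.residueField y := (Y.residue y).hom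
  have hres (x : Y.presheaf.stalk y) : res x = 0 ↔ ¬ IsUnit x := IsLocalRing.residue_eq_zero_iff x
  -- The difference `a g x - x` dies under `c`, so it is not a unit: `G` acts trivially on the
  -- residue field at `y`.
  have hresa (g : Gal(L/K)) (x : Y.presheaf.stalk y) : res (a g x) = res x := by
    rw [← sub_eq_zero, ← map_sub, hres]
    intro hu
    have := hu.map c.hom
    rw [map_sub, hca, sub_self] at this
    exact not_isUnit_zero this
  let h₁ : integralClosure O L →+* Y.residueField y := res.comp ψ
  have hh₁ : Spec.map (CommRingCat.ofHom h₁) = Y.fromSpecResidueField y ≫ φ := by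
    change Spec.map (CommRingCat.ofHom ψ ≫ Y.residue y) = _
    rw [Spec.map_comp, hψ]
    exact (Category.assoc _ _ _).symm
  have hloc : IsLocalHom h₁ := ⟨fun b hb ↦ by
    have : IsUnit (ψ b) := by
      by_contra hu
      have h0 := (hres _).mpr hu
      rw [RingHom.comp_apply, h0] at hb
      exact not_isUnit_zero hb
    have := this.map c.hom
    rw [hcψ] at this
    exact isUnit_of_map_unit h₀ b this⟩
  -- As `y` is closed, the inclusion of its residue field is a closed immersion, hence of finite
  -- type.
  have hft : h₁.FiniteType := by
    have := isClosed_singleton_iff_isClosedImmersion.mp hyc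
    have : LocallyOfFiniteType (Spec.map (CommRingCat.ofHom h₁)) := by
      rw [hh₁]
      infer_instance
    exact (HasRingHomProperty.Spec_iff (P := @LocallyOfFiniteType)).mp this
  have hsurj₁ := surjective_comp_algebraMap_of_finiteType (O := O) h₁ hft
  -- Every class modulo the maximal ideal is represented in `O`, so `G` also acts trivially on the
  -- residue field of `𝒪_L`. With `hresa` this makes `f₀` below equivariant.
  have hres_surj (b : integralClosure O L) :
      ∃ o : O, b - algebraMap O _ o ∈ maximalIdeal (integralClosure O L) := by
    obtain ⟨o, ho⟩ := hsurj₁ (h₁ b)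
    refine ⟨o, fun hu ↦ ?_⟩
    have := hu.map h₁
    rw [map_sub, ← ho, RingHom.comp_apply, sub_self] at this
    exact not_isUnit_zero this
  let I := maximalIdeal (integralClosure O L)
  have hI (b : integralClosure O L) (hb : b ∈ I) : h₁ b = 0 := by
    by_contra hne
    exact hb (isUnit_of_map_unit h₁ b (isUnit_iff_ne_zero.mpr hne))
  let : Field (integralClosure O L ⧸ I) := Ideal.Quotient.field I
  let e : integralClosure O L ⧸ I ≃+* Y.residueField y :=
    RingEquiv.ofBijective (Ideal.Quotient.lift I h₁ hI) ⟨RingHom.injective _,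
      Ideal.Quotient.lift_surjective_of_surjective I hI (by
        rw [RingHom.coe_comp] at hsurj₁
        exact hsurj₁.of_comp)⟩
  have he (b : integralClosure O L) : e (Ideal.Quotient.mk I b) = res (ψ b) := rfl
  -- the equivariant lift
  let := ψ.toAlgebra
  have : Algebra.FormallySmooth (integralClosure O L) (Y.presheaf.stalk y) :=
    formallySmooth_of_spec_map_eq φ y (CommRingCat.ofHom ψ) hψ
  let f₀ : Y.presheaf.stalk y →ₐ[integralClosure O L] integralClosure O L ⧸ I :=
    { toRingHom := (e.symm : _ →+* _).comp res
      commutes' := fun b ↦ (RingEquiv.symm_apply_eq e).mpr (he b).symm }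
  have hf₀ (x : Y.presheaf.stalk y) : f₀ x = e.symm (res x) := rfl
  have hunit : IsUnit (Nat.card Gal(L/K) : integralClosure O L) := by
    simpa using (isUnit_natCast_of_coprime_ringExpChar Nat.card_pos.ne' hTame).map
      (algebraMap O (integralClosure O L))
  obtain ⟨f, hf, hfa⟩ := exists_equivariant_lift_of_isAdicComplete
    (actionHom Gal(L/K) (integralClosure O L)) a (actionHom Gal(L/K) (integralClosure O L))
    haψ (fun g x ↦ rfl) I actionHom_mem_maximalIdeal hunit f₀ (fun g x b hb ↦ by
      rw [hf₀, hresa, ← hf₀, hb, Ideal.Quotient.eq, actionHom_apply]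
      obtain ⟨o, ho⟩ := hres_surj b
      have h2 := actionHom_mem_maximalIdeal (G := Gal(L/K)) g ho
      rw [Ideal.mem_comap, map_sub, actionHom_apply, actionHom_apply,
        smul_algebraMap_integralClosure] at h2
      simpa using I.sub_mem ho h2)
  let fr : Y.presheaf.stalk y →+* integralClosure O L := f.toRingHom
  -- Locality of the lift is what makes `σ` send the closed point to `y`.
  have hfloc : IsLocalHom fr := ⟨fun x hx ↦ by
    by_contra hu
    have h1 := hf x
    rw [hf₀, (hres x).mpr hu, map_zero, Ideal.Quotient.eq_zero_iff_mem] at h1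
    exact h1 hx⟩
  let F : Y.presheaf.stalk y ⟶ .of (integralClosure O L) := CommRingCat.ofHom fr
  refine ⟨Spec.map F ≫ ι, ?_, fun g ↦ ?_, ?_⟩
  · rw [Category.assoc, ← hψ, ← Spec.map_comp, ← Spec.map_id]
    congr 1
    ext b : 2
    exact f.commutes b
  · have h1 : Y.fromSpecStalk y ≫ (ρ g).hom =
        Spec.map (CommRingCat.ofHom (a g⁻¹)) ≫ Y.fromSpecStalk y := by rw [ha, inv_inv]
    rw [Category.assoc, h1, ← Category.assoc, ← Category.assoc]
    change (Spec.map _ ≫ Spec.map _) ≫ _ = _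
    rw [← Spec.map_comp, ← Spec.map_comp]
    congr 2
    ext x : 2
    exact (hfa g⁻¹ x).symm
  · have : IsLocalHom F.hom := hfloc
    exact spec_map_comp_fromSpecStalk_closedPoint F

end Sections

end GaloisQuotient

/-! ### The main theorem: descent of the equivariant section -/

theorem proposition4p3
    -- the complete discretely valued field `K` with ring of integers `O`, and `L/K`
    {O K L : Type u} [CommRing O] [IsDomain O] [IsDiscreteValuationRing O]
    [IsAdicComplete (IsLocalRing.maximalIdeal O) O]
    [IsAlgClosed (IsLocalRing.ResidueField O)]
    [Field K] [Algebra O K] [IsFractionRing O K]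
    [Field L] [Algebra K L] [Algebra O L] [IsScalarTower O K L]
    [FiniteDimensional K L] [IsGalois K L]
    (hTame : GaloisQuotient.IsTame O K L) (hLK : 1 < Module.finrank K L)
    -- the smooth variety `X` over `K`
    {X : Scheme.{u}} (p : X ⟶ Spec (.of K)) (hX : GaloisQuotient.IsVariety p)
    (hXsmooth : Smooth p)
    -- the smooth model `Y` of `X_L`
    {Y : Scheme.{u}} (φ : Y ⟶ GaloisQuotient.specIntegers O L)
    (j : GaloisQuotient.baseChange L p ⟶ Y)
    (hY : GaloisQuotient.IsModel (pullback.snd p (GaloisQuotient.specFieldMap K L)) φ j)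
    (hφ : Smooth φ)
    -- the good action on `Y` extending the Galois action on `X_L`
    (ρ : Gal(L/K) →* Aut Y) (hρ : GaloisQuotient.IsGoodAction ρ)
    (hj : GaloisQuotient.IsEquivariant (GaloisQuotient.galoisActionBaseChange L p) ρ j)
    -- the quotient `Q = Y/G` and its structure map to `S`
    {Q : Scheme.{u}} (π : Y ⟶ Q) (hπ : GaloisQuotient.IsQuotientBy ρ π)
    (φQ : Q ⟶ Spec (.of O)) (hφQ : π ≫ φQ = φ ≫ GaloisQuotient.specIntegersMap O L) :
    -- if `Y^G` is nonempty, then it contains a closed point of `Y`, and `Q` has an `O`-point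
    (Nonempty (GaloisQuotient.fixedLocus ρ) →
      (∃ y : Y, IsClosed {y} ∧ y ∈ Set.range (GaloisQuotient.fixedLocusι ρ)) ∧
      ∃ s : Spec (.of O) ⟶ Q, s ≫ φQ = 𝟙 _) ∧
    -- through every closed fixed point passes an equivariant section of `φ`, and it descends to
    -- a section of `φQ` through the image of that point
    (∀ y : Y, IsClosed {y} → y ∈ Set.range (GaloisQuotient.fixedLocusι ρ) →
      ∃ σ : GaloisQuotient.specIntegers O L ⟶ Y,
        σ ≫ φ = 𝟙 _ ∧
        GaloisQuotient.IsEquivariant (GaloisQuotient.galoisActionT O K L) ρ σ ∧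
        (∀ t : GaloisQuotient.specIntegers O L, IsClosed {t} → σ t = y) ∧
        ∃ s : Spec (.of O) ⟶ Q,
          GaloisQuotient.specIntegersMap O L ≫ s = σ ≫ π ∧
          (∀ s' : Spec (.of O) ⟶ Q,
            GaloisQuotient.specIntegersMap O L ≫ s' = σ ≫ π → s' = s) ∧
          s ≫ φQ = 𝟙 _ ∧
          s (IsLocalRing.closedPoint O) = π y) := by
  have hfin : Module.Finite O (integralClosure O L) :=
    GaloisQuotient.finite_integralClosure O K L
  have : IsLocalRing (integralClosure O L) :=
    GaloisQuotient.isLocalRing_of_finite_of_isAdicComplete O (integralClosure O L)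
  have : IsAdicComplete (IsLocalRing.maximalIdeal (integralClosure O L)) (integralClosure O L) :=
    GaloisQuotient.isAdicComplete_maximalIdeal_of_finite O (integralClosure O L)
  have := hY.locallyOfFiniteType
  have hequiv := GaloisQuotient.isEquivariant_of_isModel p hX φ j hY ρ hj
  have hinj := GaloisQuotient.algebraMap_integralClosure_injective O K L
  have hloc : IsLocalHom (algebraMap O (integralClosure O L)) :=
    ((algebraMap_isIntegral_iff (R := O) (A := integralClosure O L)).mpr inferInstance).isLocalHom
      hinj
  let i : CommRingCat.of O ⟶ .of (integralClosure O L) := CommRingCat.ofHom (algebraMap O _)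
  have hiloc : IsLocalHom i.hom := hloc
  have hext {Z : Scheme.{u}} {s s' : Spec (.of O) ⟶ Z}
      (h : GaloisQuotient.specIntegersMap O L ≫ s = GaloisQuotient.specIntegersMap O L ≫ s') :
      s = s' := GaloisQuotient.eq_of_spec_map_comp_eq i hinj h
  have main (y : Y) (hyc : IsClosed {y})
      (hy : y ∈ Set.range (GaloisQuotient.fixedLocusι ρ)) :
      ∃ σ : GaloisQuotient.specIntegers O L ⟶ Y,
        σ ≫ φ = 𝟙 _ ∧
        GaloisQuotient.IsEquivariant (GaloisQuotient.galoisActionT O K L) ρ σ ∧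
        (∀ t : GaloisQuotient.specIntegers O L, IsClosed {t} → σ t = y) ∧
        ∃ s : Spec (.of O) ⟶ Q,
          GaloisQuotient.specIntegersMap O L ≫ s = σ ≫ π ∧
          (∀ s' : Spec (.of O) ⟶ Q,
            GaloisQuotient.specIntegersMap O L ≫ s' = σ ≫ π → s' = s) ∧
          s ≫ φQ = 𝟙 _ ∧
          s (IsLocalRing.closedPoint O) = π y := by
    obtain ⟨σ, hσφ, hσ, hσy⟩ :=
      GaloisQuotient.exists_isEquivariant_section hTame hLK φ ρ hequiv y hyc hy
    -- Equivariance of `σ` and invariance of `π` make `σ ≫ π` invariant, and the invariants of `𝒪_L`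
    -- are `O`.
    obtain ⟨s, hs⟩ := GaloisQuotient.exists_spec_map_comp_eq_of_invariant i hinj
      (fun g : Gal(L/K) ↦ CommRingCat.ofHom
        (MulSemiringAction.toRingHom Gal(L/K) (integralClosure O L) g⁻¹))
      (fun x hx ↦ GaloisQuotient.exists_algebraMap_eq_of_smul_eq (K := K) x fun g ↦ by
        have := hx g⁻¹
        rwa [inv_inv] at this)
      (σ ≫ π) (fun g ↦ by
        have h1 : (GaloisQuotient.galoisActionT O K L g).hom ≫ σ ≫ π = σ ≫ π := by
          rw [← Category.assoc, hσ, Category.assoc, hπ.invariant]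
        exact h1)
    refine ⟨σ, hσφ, hσ, fun t ht ↦ ?_, s, hs, fun s' hs' ↦ hext (hs'.trans hs.symm), ?_, ?_⟩
    · have ht' : t = IsLocalRing.closedPoint (integralClosure O L) :=
        PrimeSpectrum.ext (IsLocalRing.eq_maximalIdeal
          ((PrimeSpectrum.isClosed_singleton_iff_isMaximal t).mp ht))
      rw [ht']
      exact hσy
    -- Morphisms out of `S` are determined after composition with `T ⟶ S`, where both sides become
    -- `T ⟶ S` itself.
    · apply hext
      change Spec.map i ≫ s ≫ φQ = Spec.map i ≫ 𝟙 _
      rw [← Category.assoc, hs, Category.assoc, hφQ, ← Category.assoc, hσφ, Category.id_comp,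
        Category.comp_id]
    · rw [← hσy, ← GaloisQuotient.comp_apply_closedPoint, ← hs,
        GaloisQuotient.comp_apply_closedPoint, Spec_closedPoint]
  refine ⟨fun hne ↦ ?_, main⟩
  obtain ⟨y, hyc, hy⟩ := GaloisQuotient.exists_isClosed_mem_range_fixedLocusι hLK φ ρ hequiv
  obtain ⟨-, -, -, -, s, -, -, hs, -⟩ := main y hyc hy
  exact ⟨⟨y, hyc, hy⟩, s, hs⟩
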